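/- Let $D^{1,2}(\mathbb{R}^3)$ be the space of real-valued functions $u \in L^6(\mathbb{R}^3)$ whose weak gradient satisfies $|\nabla u| \in L^2(\mathbb{R}^3)$, and let $$E(\mathbb{R}^3) = \Big\{ u \in D^{1,2}(\mathbb{R}^3) : \int_{\mathbb{R}^3}\int_{\mathbb{R}^3} \frac{u(x)^2\, u(y)^2}{|x-y|}\, dx\, dy < +\infty \Big\}.$$ Then $E(\mathbb{R}^3) \subset L^p(\mathbb{R}^3)$ for every $p \in [3,6)$. On the other hand, for every $p \in (0,3)$ the inclusion $E(\mathbb{R}^3) \subset L^p(\mathbb{R}^3)$ does not hold, i.e. there is $u \in E(\mathbb{R}^3)$ with $\int_{\mathbb{R}^3} |u|^p\, dx = +\infty$. -/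

import Mathlib

open MeasureTheory
open scoped ENNReal ContDiff

/-- Three-dimensional space with the Euclidean norm and Lebesgue measure. -/
abbrev R3 : Type := EuclideanSpace ℝ (Fin 3)

/-- `G` is the weak (distributional) gradient of `u` on `ℝ³`: both are locally integrable and
`∫ u ∂_v φ = - ∫ ⟨G, v⟩ φ` for every test function `φ ∈ C₀^∞(ℝ³)` and every direction `v`. -/
structure HasWeakGradient (u : R3 → ℝ) (G : R3 → R3) : Prop where
  locallyIntegrable : LocallyIntegrable u volume
  locallyIntegrable_grad : LocallyIntegrable G volume
  integral_eq : ∀ φ : R3 → ℝ, ContDiff ℝ ∞ φ → HasCompactSupport φ → ∀ v : R3,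
    ∫ x, u x * fderiv ℝ φ x v = - ∫ x, inner ℝ (G x) v * φ x

/-- `D^{1,2}(ℝ³) = {u ∈ L⁶(ℝ³) : |∇u| ∈ L²(ℝ³)}`, on the level of representatives. -/
def spaceD12 : Set (R3 → ℝ) :=
  {u | MemLp u 6 volume ∧ ∃ G : R3 → R3, HasWeakGradient u G ∧ MemLp G 2 volume}

/-- The Coulomb energy `∫∫ u(x)² u(y)² / |x - y| dx dy`, with values in `[0, ∞]`.
The diagonal, where the quotient is `0` by convention, is a null set. -/
noncomputable def coulombEnergy (u : R3 → ℝ) : ℝ≥0∞ :=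
  ∫⁻ x : R3, ∫⁻ y : R3, ENNReal.ofReal (u x ^ 2 * u y ^ 2 / ‖x - y‖)

/-- `E(ℝ³)`: the functions in `D^{1,2}(ℝ³)` with finite Coulomb energy. -/
def spaceE : Set (R3 → ℝ) :=
  {u | u ∈ spaceD12 ∧ coulombEnergy u < (⊤ : ℝ≥0∞)}

/-- `L^p(ℝ³)`, on the level of representatives. For `0 < p < ∞` this means measurability almost
everywhere together with `∫ |u|^p < ∞`. -/
def spaceLp (p : ℝ≥0∞) : Set (R3 → ℝ) :=
  {u | MemLp u p volume}

/-!
A function which is small at infinity is controlled by its gradient through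
`|u| ≤ C |·|⁻² * |∇u|`: integrate the derivative along every ray. The kernel `|·|⁻²` is even and
its self-convolution is at most a multiple of the Coulomb kernel `|·|⁻¹`, so moving it onto `u²`
and applying the Cauchy-Schwarz inequality gives
`∫ |u|³ ≤ ∫ (|·|⁻² * u²) |∇u| ≤ C (∬ u(x)² u(y)² / |x - y|)^(1/2) (∫ |∇u|²)^(1/2)`,
and the exponents between `3` and `6` follow by interpolation.

For `p < 3` take a superposition of bumps of radius `Rₙ ≥ 1` and height `Rₙ⁻²`, so far apart that
they hardly interact. Both `∫ |∇u|²` and the Coulomb energy are then of the order of `∑ Rₙ⁻³`,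
`∫ u⁶` is smaller still, and `∫ |u|ᵖ` is of the order of `∑ Rₙ^(3 - 2p)`, which diverges for a
suitable choice of the radii with `∑ Rₙ⁻³ < ∞`.
-/

open Set Module Metric Filter Topology
open scoped Convolution

section RieszKernel

variable {E : Type*} [NormedAddCommGroup E]

/-- The Riesz kernel `|z|⁻ᵐ`, with value `∞` at the origin for `m ≠ 0`. On `ℝ³` the case
`m = 1` is the Coulomb kernel and the case `m = 2` recovers a function from its gradient. -/
noncomputable def rieszKernel (m : ℕ) (z : E) : ℝ≥0∞ := (‖z‖ₑ ^ m)⁻¹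

theorem rieszKernel_neg (m : ℕ) (z : E) : rieszKernel m (-z) = rieszKernel m z := by
  simp only [rieszKernel, enorm_neg]

theorem rieszKernel_add (m k : ℕ) (z : E) :
    rieszKernel (m + k) z = rieszKernel m z * rieszKernel k z := by
  unfold rieszKernel
  rw [pow_add, ENNReal.mul_inv (by simp) (by simp)]

theorem rieszKernel_le_of_le_norm {R : ℝ} (m : ℕ) {z : E} (h : R ≤ ‖z‖) :
    rieszKernel m z ≤ (ENNReal.ofReal R ^ m)⁻¹ := by
  unfold rieszKernel
  gcongr
  simpa only [← ofReal_norm] using ENNReal.ofReal_le_ofReal h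

/- Of the two points `y` and `x - y` the one further from the origin has norm at least `|x| / 2`. -/
theorem rieszKernel_mul_rieszKernel_le (a b : ℕ) (x y : E) :
    rieszKernel a y * rieszKernel b (-y + x) ≤
      rieszKernel a y * min (ENNReal.ofReal (‖x‖ / 2) ^ b)⁻¹ (rieszKernel b y) +
      rieszKernel b (-y + x) *
        min (ENNReal.ofReal (‖x‖ / 2) ^ a)⁻¹ (rieszKernel a (-y + x)) := by
  have htri : ‖x‖ ≤ ‖y‖ + ‖-y + x‖ := by simpa using norm_add_le y (-y + x)
  rcases le_total ‖y‖ ‖-y + x‖ with h | h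
  · refine le_add_right ?_
    gcongr
    refine le_min (rieszKernel_le_of_le_norm b (by linarith)) ?_
    simpa only [rieszKernel, ofReal_norm] using rieszKernel_le_of_le_norm b h
  · refine le_add_left ?_
    rw [mul_comm]
    gcongr
    refine le_min (rieszKernel_le_of_le_norm a (by linarith)) ?_
    simpa only [rieszKernel, ofReal_norm] using rieszKernel_le_of_le_norm a h

@[fun_prop]
theorem measurable_rieszKernel [MeasurableSpace E] [BorelSpace E] (m : ℕ) :
    Measurable (rieszKernel (E := E) m) := by
  unfold rieszKernel
  fun_prop

end RieszKernel

section PolarCoordinates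

variable {E : Type*} [NormedAddCommGroup E] [NormedSpace ℝ E] [FiniteDimensional ℝ E]
  [Nontrivial E] [MeasurableSpace E] [BorelSpace E] (μ : Measure E) [μ.IsAddHaarMeasure]

theorem lintegral_eq_lintegral_sphere_lintegral_Ioi {f : E → ℝ≥0∞} (hf : Measurable f) :
    ∫⁻ x, f x ∂μ = ∫⁻ θ, ∫⁻ r in Ioi (0 : ℝ),
      ENNReal.ofReal (r ^ (finrank ℝ E - 1)) * f (r • (θ : E)) ∂volume ∂μ.toSphere := by
  set e := homeomorphUnitSphereProd E
  calc ∫⁻ x, f x ∂μ = ∫⁻ x : ({0}ᶜ : Set E), f x ∂μ.comap (↑) := by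
        rw [lintegral_subtype_comap (measurableSet_singleton _).compl, restrict_compl_singleton]
    _ = ∫⁻ p, f (e.symm p) ∂μ.toSphere.prod (.volumeIoiPow (finrank ℝ E - 1)) := by
        rw [← μ.measurePreserving_homeomorphUnitSphereProd.lintegral_comp_emb
          e.measurableEmbedding]
        simp [e]
    _ = _ := by
        have he : Measurable fun p => f (e.symm p) :=
          hf.comp (measurable_subtype_coe.comp e.symm.measurable)
        rw [lintegral_prod _ he.aemeasurable]
        refine lintegral_congr fun θ => ?_
        simp only [e, homeomorphUnitSphereProd_symm_apply_coe]
        rw [Measure.volumeIoiPow, lintegral_withDensity_eq_lintegral_mul _ (by fun_prop)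
          (by fun_prop), ← lintegral_subtype_comap measurableSet_Ioi]
        rfl

theorem lintegral_rieszKernel_mul_eq_lintegral_sphere {g : E → ℝ≥0∞} (hg : Measurable g) :
    ∫⁻ z, rieszKernel (finrank ℝ E - 1) z * g z ∂μ =
      ∫⁻ θ, ∫⁻ r in Ioi (0 : ℝ), g (r • (θ : E)) ∂volume ∂μ.toSphere := by
  rw [lintegral_eq_lintegral_sphere_lintegral_Ioi μ (by fun_prop)]
  refine lintegral_congr fun θ => setLIntegral_congr_fun measurableSet_Ioi fun r hr => ?_
  have hr : 0 < r := hr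
  have hk : rieszKernel (finrank ℝ E - 1) (r • (θ : E)) =
      (ENNReal.ofReal (r ^ (finrank ℝ E - 1)))⁻¹ := by
    rw [rieszKernel, ← ofReal_norm, norm_smul, norm_eq_of_mem_sphere, mul_one,
      Real.norm_of_nonneg hr.le, ENNReal.ofReal_pow hr.le]
  have hpos : 0 < r ^ (finrank ℝ E - 1) := pow_pos hr _
  simp only [hk]
  rw [← mul_assoc, ENNReal.mul_inv_cancel (by simpa using hpos) ENNReal.ofReal_ne_top, one_mul]

theorem lintegral_comp_norm_eq {h : ℝ → ℝ≥0∞} (hh : Measurable h) :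
    ∫⁻ x, h ‖x‖ ∂μ = finrank ℝ E * μ (ball 0 1) *
      ∫⁻ r in Ioi (0 : ℝ), ENNReal.ofReal (r ^ (finrank ℝ E - 1)) * h r := by
  have hθ (θ : sphere (0 : E) 1) :
      ∫⁻ r in Ioi (0 : ℝ), ENNReal.ofReal (r ^ (finrank ℝ E - 1)) * h ‖r • (θ : E)‖ =
        ∫⁻ r in Ioi (0 : ℝ), ENNReal.ofReal (r ^ (finrank ℝ E - 1)) * h r :=
    setLIntegral_congr_fun measurableSet_Ioi fun r hr => by
      simp only [norm_smul, norm_eq_of_mem_sphere, Real.norm_of_nonneg (le_of_lt hr), mul_one]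
  rw [lintegral_eq_lintegral_sphere_lintegral_Ioi μ (by fun_prop)]
  simp_rw [hθ]
  rw [lintegral_const, μ.toSphere_apply_univ, mul_comm]

end PolarCoordinates

section RepresentationFormula

variable {E F : Type*} [NormedAddCommGroup E] [NormedSpace ℝ E] [NormedAddCommGroup F]
  [NormedSpace ℝ F] {w : E → F}

theorem enorm_le_enorm_add_lintegral_fderiv_ray (hw : ContDiff ℝ 1 w) (x v : E) {R : ℝ}
    (hR : 0 ≤ R) :
    ‖w x‖ₑ ≤ ‖w (x + R • v)‖ₑ + ∫⁻ r in Ioi (0 : ℝ), ‖fderiv ℝ w (x + r • v)‖ₑ * ‖v‖ₑ := by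
  have hγ : ContDiff ℝ 1 fun r : ℝ => x + r • v := by fun_prop
  have hderiv (r : ℝ) : deriv (fun r : ℝ => w (x + r • v)) r = fderiv ℝ w (x + r • v) v := by
    have hline : HasDerivAt (fun r : ℝ => x + r • v) v r := by
      simpa using ((hasDerivAt_id r).smul_const v).const_add x
    exact ((hw.differentiable one_ne_zero _).hasFDerivAt.comp_hasDerivAt r hline).deriv
  have hftc : ‖w (x + R • v) - w x‖ₑ ≤
      ∫⁻ r in Icc 0 R, ‖deriv (fun r : ℝ => w (x + r • v)) r‖ₑ := by
    simpa using enorm_sub_le_lintegral_deriv_of_contDiffOn_Icc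
      (f := fun r : ℝ => w (x + r • v)) (hw.comp hγ).contDiffOn hR
  calc ‖w x‖ₑ ≤ ‖w (x + R • v)‖ₑ + ‖w (x + R • v) - w x‖ₑ := by
        simpa using enorm_sub_le (a := w (x + R • v)) (b := w (x + R • v) - w x)
    _ ≤ ‖w (x + R • v)‖ₑ + ∫⁻ r in Ioc 0 R, ‖fderiv ℝ w (x + r • v)‖ₑ * ‖v‖ₑ := by
        gcongr
        refine hftc.trans ?_
        rw [restrict_Ioc_eq_restrict_Icc]
        refine lintegral_mono fun r => ?_
        rw [hderiv]
        exact ContinuousLinearMap.le_opENorm _ _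
    _ ≤ _ := by
        gcongr
        exact Ioc_subset_Ioi_self

theorem eq_zero_of_forall_le_of_lintegral_pow_mul_ne_top {m : ℕ} {g : ℝ → ℝ≥0∞} {c : ℝ≥0∞}
    (hg : ∫⁻ r in Ioi (0 : ℝ), ENNReal.ofReal (r ^ m) * g r ≠ ⊤) (hc : ∀ r > 0, c ≤ g r) :
    c = 0 := by
  by_contra hc0
  refine hg (top_le_iff.mp ?_)
  calc ⊤ = ∫⁻ _ in Ioi (1 : ℝ), c := by simp [ENNReal.mul_top, hc0]
    _ ≤ ∫⁻ r in Ioi (1 : ℝ), ENNReal.ofReal (r ^ m) * g r := by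
        refine setLIntegral_mono' measurableSet_Ioi fun r (hr : 1 < r) => ?_
        have hpow : 1 ≤ ENNReal.ofReal (r ^ m) := by
          simpa using one_le_pow₀ hr.le
        exact (hc r (zero_lt_one.trans hr)).trans (le_mul_of_one_le_left' hpow)
    _ ≤ _ := lintegral_mono_set (Ioi_subset_Ioi zero_le_one)

variable [FiniteDimensional ℝ E] [Nontrivial E] [MeasurableSpace E] [BorelSpace E]
  (μ : Measure E) [μ.IsAddHaarMeasure] {p : ℝ}

/- On almost every ray `|w|ᵖ` has finite weighted integral, so `w` is not bounded away from zero
there. -/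
theorem ae_enorm_le_lintegral_fderiv_ray (hw : ContDiff ℝ 1 w) (hp : 0 < p)
    (hwp : ∫⁻ y, ‖w y‖ₑ ^ p ∂μ ≠ ⊤) (x : E) :
    ∀ᵐ θ : sphere (0 : E) 1 ∂μ.toSphere,
      ‖w x‖ₑ ≤ ∫⁻ r in Ioi (0 : ℝ), ‖fderiv ℝ w (x + r • (θ : E))‖ₑ := by
  have hmeas : Measurable fun z => ‖w (x + z)‖ₑ ^ p :=
    ((hw.continuous.comp (continuous_const.add continuous_id)).enorm.measurable).pow_const p
  have hshift : ∫⁻ z, ‖w (x + z)‖ₑ ^ p ∂μ ≠ ⊤ := by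
    rwa [lintegral_add_left_eq_self fun y => ‖w y‖ₑ ^ p]
  rw [lintegral_eq_lintegral_sphere_lintegral_Ioi μ hmeas] at hshift
  have hm : Measurable fun θ : sphere (0 : E) 1 => ∫⁻ r in Ioi (0 : ℝ),
      ENNReal.ofReal (r ^ (finrank ℝ E - 1)) * ‖w (x + r • (θ : E))‖ₑ ^ p := by
    refine Measurable.lintegral_prod_right' (f := fun q : sphere (0 : E) 1 × ℝ =>
      ENNReal.ofReal (q.2 ^ (finrank ℝ E - 1)) * ‖w (x + q.2 • (q.1 : E))‖ₑ ^ p) ?_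
    exact (by fun_prop : Measurable fun q : sphere (0 : E) 1 × ℝ =>
      ENNReal.ofReal (q.2 ^ (finrank ℝ E - 1))).mul (hmeas.comp (by fun_prop))
  filter_upwards [ae_lt_top hm hshift] with θ hθ
  set D := ∫⁻ r in Ioi (0 : ℝ), ‖fderiv ℝ w (x + r • (θ : E))‖ₑ
  have hle (r : ℝ) (hr : 0 < r) : (‖w x‖ₑ - D) ^ p ≤ ‖w (x + r • (θ : E))‖ₑ ^ p := by
    have hray := enorm_le_enorm_add_lintegral_fderiv_ray hw x (θ : E) hr.le
    have hθ1 : ‖(θ : E)‖ₑ = 1 := by rw [← ofReal_norm, norm_eq_of_mem_sphere, ENNReal.ofReal_one]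
    simp only [hθ1, mul_one] at hray
    gcongr
    exact tsub_le_iff_right.mpr hray
  have hzero := eq_zero_of_forall_le_of_lintegral_pow_mul_ne_top hθ.ne hle
  exact tsub_eq_zero_iff_le.mp ((ENNReal.rpow_eq_zero_iff_of_pos hp).mp hzero)

theorem enorm_le_lconvolution_rieszKernel_fderiv (hw : ContDiff ℝ 1 w) (hp : 0 < p)
    (hwp : ∫⁻ y, ‖w y‖ₑ ^ p ∂μ ≠ ⊤) (x : E) :
    finrank ℝ E * μ (ball 0 1) * ‖w x‖ₑ ≤
      (rieszKernel (finrank ℝ E - 1) ⋆ₗ[μ] fun y => ‖fderiv ℝ w y‖ₑ) x := by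
  have hmeas : Measurable fun z => ‖fderiv ℝ w (x + z)‖ₑ :=
    ((hw.continuous_fderiv one_ne_zero).comp (continuous_const.add continuous_id)).enorm.measurable
  calc finrank ℝ E * μ (ball 0 1) * ‖w x‖ₑ = ∫⁻ _, ‖w x‖ₑ ∂μ.toSphere := by
        rw [lintegral_const, μ.toSphere_apply_univ, mul_comm]
    _ ≤ ∫⁻ θ, ∫⁻ r in Ioi (0 : ℝ), ‖fderiv ℝ w (x + r • (θ : E))‖ₑ ∂volume ∂μ.toSphere :=
        lintegral_mono_ae (ae_enorm_le_lintegral_fderiv_ray μ hw hp hwp x)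
    _ = ∫⁻ z, rieszKernel (finrank ℝ E - 1) z * ‖fderiv ℝ w (x + z)‖ₑ ∂μ :=
        (lintegral_rieszKernel_mul_eq_lintegral_sphere μ hmeas).symm
    _ = _ := by
        rw [lconvolution_def, ← lintegral_neg_eq_self]
        simp only [rieszKernel_neg, add_comm]

end RepresentationFormula

section KernelEstimates

theorem lintegral_Ioi_inv_pow_succ_le {j : ℕ} (hj : j ≠ 0) {R : ℝ} (hR : 0 < R) :
    ∫⁻ r in Ioi R, (ENNReal.ofReal r ^ (j + 1))⁻¹ ≤ (ENNReal.ofReal R ^ j)⁻¹ := by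
  have hj1 : (1 : ℝ) ≤ j := by exact_mod_cast Nat.one_le_iff_ne_zero.mpr hj
  have hexp : (-(j + 1 : ℝ)) < -1 := by linarith
  have hpow {r : ℝ} (hr : 0 < r) :
      (ENNReal.ofReal r ^ (j + 1))⁻¹ = ENNReal.ofReal (r ^ (-(j + 1 : ℝ))) := by
    rw [← ENNReal.ofReal_pow hr.le, ← ENNReal.ofReal_inv_of_pos (by positivity),
      Real.rpow_neg hr.le]
    norm_cast
  calc ∫⁻ r in Ioi R, (ENNReal.ofReal r ^ (j + 1))⁻¹
      = ∫⁻ r in Ioi R, ENNReal.ofReal (r ^ (-(j + 1 : ℝ))) :=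
        setLIntegral_congr_fun measurableSet_Ioi fun r hr => hpow (hR.trans hr)
    _ = ENNReal.ofReal (∫ r in Ioi R, r ^ (-(j + 1 : ℝ))) :=
        (ofReal_integral_eq_lintegral_ofReal (integrableOn_Ioi_rpow_of_lt hexp hR)
          (ae_restrict_of_forall_mem measurableSet_Ioi fun r hr =>
            Real.rpow_nonneg (hR.trans hr).le _)).symm
    _ = ENNReal.ofReal ((R ^ j)⁻¹ / j) := by
        rw [integral_Ioi_rpow_of_lt hexp hR, neg_add, neg_add_cancel_right, neg_div_neg_eq,
          Real.rpow_neg hR.le, Real.rpow_natCast]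
    _ ≤ (ENNReal.ofReal R ^ j)⁻¹ := by
        rw [← ENNReal.ofReal_pow hR.le, ← ENNReal.ofReal_inv_of_pos (by positivity)]
        exact ENNReal.ofReal_le_ofReal (div_le_self (by positivity) hj1)

variable {E : Type*} [NormedAddCommGroup E] [NormedSpace ℝ E] [FiniteDimensional ℝ E]
  [Nontrivial E] [MeasurableSpace E] [BorelSpace E] (μ : Measure E) [μ.IsAddHaarMeasure]

theorem setLIntegral_norm_preimage_rieszKernel {s : Set ℝ} (hs : MeasurableSet s) (m : ℕ) :
    ∫⁻ z : E in norm ⁻¹' s, rieszKernel m z ∂μ = finrank ℝ E * μ (ball 0 1) *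
      ∫⁻ r in s ∩ Ioi (0 : ℝ), ENNReal.ofReal r ^ (finrank ℝ E - 1) * (ENNReal.ofReal r ^ m)⁻¹ := by
  rw [← lintegral_indicator (hs.preimage measurable_norm), ← setLIntegral_indicator hs]
  have hind (z : E) : (norm ⁻¹' s).indicator (rieszKernel m) z =
      s.indicator (fun r => (ENNReal.ofReal r ^ m)⁻¹) ‖z‖ := by
    simp only [indicator, rieszKernel, ofReal_norm]
    rfl
  simp_rw [hind]
  rw [lintegral_comp_norm_eq μ ((by fun_prop : Measurable _).indicator hs)]
  congr 1
  refine setLIntegral_congr_fun measurableSet_Ioi fun r hr => ?_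
  by_cases hrs : r ∈ s <;> simp [hrs, ENNReal.ofReal_pow (le_of_lt hr)]

theorem setLIntegral_ball_rieszKernel_le {m : ℕ} (hm : m < finrank ℝ E) (R : ℝ) :
    ∫⁻ z in ball 0 R, rieszKernel m z ∂μ ≤
      finrank ℝ E * μ (ball 0 1) * ENNReal.ofReal R ^ (finrank ℝ E - m) := by
  have hball : ball (0 : E) R = norm ⁻¹' Iio R := by ext; simp
  rw [hball, setLIntegral_norm_preimage_rieszKernel μ measurableSet_Iio]
  gcongr
  obtain ⟨j, hj⟩ := Nat.exists_eq_add_of_lt hm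
  have hj1 : finrank ℝ E - 1 = j + m := by omega
  have hjm : finrank ℝ E - m = j + 1 := by omega
  rw [hj1, hjm, Iio_inter_Ioi]
  calc ∫⁻ r in Ioo 0 R, ENNReal.ofReal r ^ (j + m) * (ENNReal.ofReal r ^ m)⁻¹
      ≤ ∫⁻ _ in Ioo 0 R, ENNReal.ofReal R ^ j := by
        refine setLIntegral_mono' measurableSet_Ioo fun r hr => ?_
        have hr0 : ENNReal.ofReal r ^ m ≠ 0 := by simp [hr.1]
        rw [pow_add, mul_assoc, ENNReal.mul_inv_cancel hr0 (by finiteness), mul_one]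
        gcongr
        exact hr.2.le
    _ = ENNReal.ofReal R ^ (j + 1) := by
        rw [setLIntegral_const, Real.volume_Ioo, sub_zero, pow_succ]

theorem setLIntegral_compl_ball_rieszKernel_le {m : ℕ} (hm : finrank ℝ E < m) {R : ℝ}
    (hR : 0 < R) :
    ∫⁻ z in (ball 0 R)ᶜ, rieszKernel m z ∂μ ≤
      finrank ℝ E * μ (ball 0 1) * (ENNReal.ofReal R ^ (m - finrank ℝ E))⁻¹ := by
  have hball : (ball (0 : E) R)ᶜ = norm ⁻¹' Ici R := by ext; simp
  have hIci : Ici R ∩ Ioi (0 : ℝ) = Ici R := inter_eq_left.mpr (Ici_subset_Ioi.mpr hR)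
  rw [hball, setLIntegral_norm_preimage_rieszKernel μ measurableSet_Ici, hIci]
  gcongr
  refine le_trans (le_of_eq ?_) (lintegral_Ioi_inv_pow_succ_le (by omega) hR)
  rw [← restrict_Ioi_eq_restrict_Ici]
  refine setLIntegral_congr_fun measurableSet_Ioi fun r (hr : R < r) => ?_
  have hr0 : ENNReal.ofReal r ^ (finrank ℝ E - 1) ≠ 0 := by simp [hR.trans hr]
  have hn : 0 < finrank ℝ E := finrank_pos
  have hexp : m = finrank ℝ E - 1 + (m - finrank ℝ E + 1) := by omega
  calc ENNReal.ofReal r ^ (finrank ℝ E - 1) * (ENNReal.ofReal r ^ m)⁻¹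
      = ENNReal.ofReal r ^ (finrank ℝ E - 1) *
          (ENNReal.ofReal r ^ (finrank ℝ E - 1 + (m - finrank ℝ E + 1)))⁻¹ := by rw [← hexp]
    _ = _ := by
        rw [pow_add _ (finrank ℝ E - 1), ENNReal.mul_inv (Or.inl hr0)
          (Or.inl (by finiteness)), ← mul_assoc,
          ENNReal.mul_inv_cancel hr0 (by finiteness), one_mul]

theorem lintegral_rieszKernel_mul_min_le {a b : ℕ} (ha : a < finrank ℝ E)
    (hab : finrank ℝ E < a + b) {R : ℝ} (hR : 0 < R) :
    ∫⁻ z : E, rieszKernel a z * min (ENNReal.ofReal R ^ b)⁻¹ (rieszKernel b z) ∂μ ≤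
      2 * (finrank ℝ E * μ (ball 0 1)) * (ENNReal.ofReal R ^ (a + b - finrank ℝ E))⁻¹ := by
  have hR0 : ENNReal.ofReal R ≠ 0 := by simpa using hR
  have hexp : b = (finrank ℝ E - a) + (a + b - finrank ℝ E) := by omega
  have hnear : ∫⁻ z in ball 0 R, rieszKernel a z * min (ENNReal.ofReal R ^ b)⁻¹ (rieszKernel b z) ∂μ
      ≤ finrank ℝ E * μ (ball 0 1) * (ENNReal.ofReal R ^ (a + b - finrank ℝ E))⁻¹ := by
    calc _ ≤ ∫⁻ z in ball 0 R, rieszKernel a z * (ENNReal.ofReal R ^ b)⁻¹ ∂μ := by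
          gcongr
          exact min_le_left _ _
      _ ≤ finrank ℝ E * μ (ball 0 1) * ENNReal.ofReal R ^ (finrank ℝ E - a) *
            (ENNReal.ofReal R ^ (finrank ℝ E - a + (a + b - finrank ℝ E)))⁻¹ := by
          rw [lintegral_mul_const _ (by fun_prop), ← hexp]
          gcongr
          exact setLIntegral_ball_rieszKernel_le μ ha R
      _ = _ := by
          rw [pow_add, ENNReal.mul_inv (by simp [hR0]) (by simp), mul_assoc, ← mul_assoc (_ ^ _),
            ENNReal.mul_inv_cancel (by simp [hR0]) (by finiteness), one_mul]
  have hfar : ∫⁻ z in (ball 0 R)ᶜ, rieszKernel a z *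
        min (ENNReal.ofReal R ^ b)⁻¹ (rieszKernel b z) ∂μ
      ≤ finrank ℝ E * μ (ball 0 1) * (ENNReal.ofReal R ^ (a + b - finrank ℝ E))⁻¹ := by
    refine le_trans (lintegral_mono fun z => ?_) (setLIntegral_compl_ball_rieszKernel_le μ hab hR)
    rw [rieszKernel_add]
    gcongr
    exact min_le_right _ _
  calc _ = _ := (lintegral_add_compl _ (measurableSet_ball (x := (0 : E)) (ε := R))).symm
    _ ≤ _ := add_le_add hnear hfar
    _ = _ := by ring

theorem exists_lconvolution_rieszKernel_le {a b : ℕ} (ha : a < finrank ℝ E)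
    (hb : b < finrank ℝ E) (hab : finrank ℝ E < a + b) :
    ∃ C : ℝ≥0∞, C ≠ ⊤ ∧ ∀ x : E, (rieszKernel a ⋆ₗ[μ] rieszKernel b) x ≤
      C * rieszKernel (a + b - finrank ℝ E) x := by
  set j := a + b - finrank ℝ E with hj
  have hB : μ (ball (0 : E) 1) ≠ 0 := (measure_ball_pos μ 0 one_pos).ne'
  have hn : (finrank ℝ E : ℝ≥0∞) ≠ 0 := by exact_mod_cast finrank_pos.ne'
  refine ⟨4 * (finrank ℝ E * μ (ball 0 1)) * 2 ^ j, by finiteness, fun x => ?_⟩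
  rcases eq_or_ne x 0 with rfl | hx
  · have hj0 : j ≠ 0 := by omega
    simp [rieszKernel, hj0, ENNReal.mul_top, hB, hn]
  have hR : 0 < ‖x‖ / 2 := by positivity
  have hscale : (ENNReal.ofReal (‖x‖ / 2) ^ j)⁻¹ = 2 ^ j * rieszKernel j x := by
    rw [ENNReal.ofReal_div_of_pos two_pos, ofReal_norm, ENNReal.ofReal_ofNat, div_eq_mul_inv,
      mul_pow, ← ENNReal.inv_pow, ENNReal.mul_inv (by simp) (by simp), inv_inv, mul_comm]
    rfl
  have hfirst := lintegral_rieszKernel_mul_min_le μ ha hab hR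
  have hsecond := lintegral_rieszKernel_mul_min_le μ hb (add_comm a b ▸ hab) hR
  rw [← lintegral_sub_left_eq_self _ x, add_comm b a] at hsecond
  rw [← hj, hscale] at hfirst hsecond
  calc (rieszKernel a ⋆ₗ[μ] rieszKernel b) x
      ≤ _ := lintegral_mono fun y => rieszKernel_mul_rieszKernel_le a b x y
    _ = _ := lintegral_add_left (by fun_prop) _
    _ ≤ 2 * (finrank ℝ E * μ (ball 0 1)) * (2 ^ j * rieszKernel j x) +
          2 * (finrank ℝ E * μ (ball 0 1)) * (2 ^ j * rieszKernel j x) := by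
        simp only [neg_add_eq_sub]
        exact add_le_add hfirst hsecond
    _ = _ := by ring

end KernelEstimates

section Convolution

theorem enorm_convolution_lsmul_le {G F : Type*} [MeasurableSpace G] [AddCommGroup G]
    [NormedAddCommGroup F] [NormedSpace ℝ F]
    (μ : Measure G) (f : G → ℝ) (g : G → F) (x : G) :
    ‖(f ⋆[ContinuousLinearMap.lsmul ℝ ℝ, μ] g) x‖ₑ ≤
      ((fun y => ‖f y‖ₑ) ⋆ₗ[μ] fun y => ‖g y‖ₑ) x := by
  rw [convolution_lsmul, lconvolution_def]
  refine (enorm_integral_le_lintegral_enorm _).trans_eq (lintegral_congr fun y => ?_)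
  rw [enorm_smul, neg_add_eq_sub]

variable {G : Type*} [MeasurableSpace G] [AddCommGroup G] [MeasurableAdd₂ G] [MeasurableNeg G]
  {μ : Measure G} [SFinite μ] [μ.IsAddLeftInvariant]

theorem lintegral_mul_lconvolution_of_even [μ.IsNegInvariant] {k f g : G → ℝ≥0∞}
    (hk : Measurable k) (hf : Measurable f) (hg : Measurable g) (heven : ∀ x, k (-x) = k x) :
    ∫⁻ x, f x * (k ⋆ₗ[μ] g) x ∂μ = ∫⁻ x, (k ⋆ₗ[μ] f) x * g x ∂μ := by
  rw [lconvolution_comm (f := k) (g := g), lconvolution_comm (f := k) (g := f)]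
  calc ∫⁻ x, f x * (g ⋆ₗ[μ] k) x ∂μ = ∫⁻ x, ∫⁻ y, f x * (g y * k (-y + x)) ∂μ ∂μ :=
        lintegral_congr fun x => (lintegral_const_mul _ (by fun_prop)).symm
    _ = ∫⁻ y, ∫⁻ x, f x * (g y * k (-y + x)) ∂μ ∂μ := lintegral_lintegral_swap (by fun_prop)
    _ = ∫⁻ y, ∫⁻ x, f x * k (-x + y) * g y ∂μ ∂μ := by
        refine lintegral_congr fun y => lintegral_congr fun x => ?_
        rw [← heven (-y + x), neg_add, neg_neg, add_comm y]
        ring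
    _ = _ := lintegral_congr fun y => lintegral_mul_const _ (by fun_prop)

theorem lintegral_lconvolution_sq_of_even [μ.IsNegInvariant] {k f : G → ℝ≥0∞}
    (hk : Measurable k) (hf : Measurable f) (heven : ∀ x, k (-x) = k x) :
    ∫⁻ x, (k ⋆ₗ[μ] f) x ^ 2 ∂μ = ∫⁻ x, f x * ((k ⋆ₗ[μ] k) ⋆ₗ[μ] f) x ∂μ := by
  simp_rw [sq]
  rw [← lintegral_mul_lconvolution_of_even hk hf (by fun_prop) heven, lconvolution_assoc hk hk hf]

theorem lintegral_mul_lconvolution_le_of_even [μ.IsNegInvariant] {k f g : G → ℝ≥0∞}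
    (hk : Measurable k) (hf : Measurable f) (hg : Measurable g) (heven : ∀ x, k (-x) = k x) :
    ∫⁻ x, f x * (k ⋆ₗ[μ] g) x ∂μ ≤
      (∫⁻ x, f x * ((k ⋆ₗ[μ] k) ⋆ₗ[μ] f) x ∂μ) ^ (1 / 2 : ℝ) *
        (∫⁻ x, g x ^ 2 ∂μ) ^ (1 / 2 : ℝ) := by
  rw [lintegral_mul_lconvolution_of_even hk hf hg heven,
    ← lintegral_lconvolution_sq_of_even hk hf heven]
  simpa only [Pi.mul_apply, ENNReal.rpow_two] using ENNReal.lintegral_mul_le_Lp_mul_Lq μ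
    Real.HolderConjugate.two_two (measurable_lconvolution μ hk hf).aemeasurable hg.aemeasurable

theorem lintegral_lconvolution_rpow_le {ρ g : G → ℝ≥0∞} (hρ : Measurable ρ) (hg : Measurable g)
    (hρ1 : ∫⁻ x, ρ x ∂μ = 1) {p : ℝ} (hp : 1 ≤ p) :
    ∫⁻ x, (ρ ⋆ₗ[μ] g) x ^ p ∂μ ≤ ∫⁻ x, g x ^ p ∂μ := by
  have hp0 : 0 < p := zero_lt_one.trans_le hp
  have : IsProbabilityMeasure (μ.withDensity ρ) := ⟨by simpa using hρ1⟩
  have hJensen (x : G) : (ρ ⋆ₗ[μ] g) x ^ p ≤ (ρ ⋆ₗ[μ] fun y => g y ^ p) x := by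
    have h := eLpNorm'_le_eLpNorm'_of_exponent_le (f := fun y => g (-y + x)) one_pos hp
      (μ.withDensity ρ)
      (hg.comp (measurable_add_const x |>.comp measurable_neg)).aestronglyMeasurable
    simp only [eLpNorm', enorm_eq_self, ENNReal.rpow_one, one_div, inv_one] at h
    rw [ENNReal.le_rpow_inv_iff hp0, lintegral_withDensity_eq_lintegral_mul _ hρ (by fun_prop),
      lintegral_withDensity_eq_lintegral_mul _ hρ (by fun_prop)] at h
    exact h
  calc ∫⁻ x, (ρ ⋆ₗ[μ] g) x ^ p ∂μ ≤ ∫⁻ x, ∫⁻ y, ρ y * g (-y + x) ^ p ∂μ ∂μ :=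
        lintegral_mono hJensen
    _ = ∫⁻ y, ∫⁻ x, ρ y * g (-y + x) ^ p ∂μ ∂μ := lintegral_lintegral_swap (by fun_prop)
    _ = ∫⁻ y, ρ y * ∫⁻ x, g x ^ p ∂μ ∂μ := by
        refine lintegral_congr fun y => ?_
        rw [lintegral_const_mul _ (by fun_prop), lintegral_add_left_eq_self fun x => g x ^ p]
    _ = _ := by rw [lintegral_mul_const _ hρ, hρ1, one_mul]

end Convolution

theorem coulombEnergy_eq_lintegral_mul_lconvolution (u : R3 → ℝ) :
    coulombEnergy u = ∫⁻ x, ‖u x‖ₑ ^ 2 * (rieszKernel 1 ⋆ₗ fun y => ‖u y‖ₑ ^ 2) x := by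
  rw [lconvolution_comm]
  refine lintegral_congr fun x => ?_
  rw [lconvolution_def, ← lintegral_const_mul' _ _ (by finiteness)]
  refine lintegral_congr_ae ?_
  filter_upwards [Measure.ae_ne volume x] with y hy
  have hpos : 0 < ‖x - y‖ := norm_pos_iff.mpr (sub_ne_zero.mpr hy.symm)
  rw [ENNReal.ofReal_div_of_pos hpos, ENNReal.ofReal_mul (sq_nonneg _), ofReal_norm,
    div_eq_mul_inv, rieszKernel, pow_one, neg_add_eq_sub, mul_assoc]
  simp only [Real.enorm_eq_ofReal_abs, ← ENNReal.ofReal_pow (abs_nonneg _), sq_abs]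

theorem HasWeakGradient.hasGradientAt_convolution {u φ : R3 → ℝ} {G : R3 → R3}
    (h : HasWeakGradient u G) (hφ : ContDiff ℝ ∞ φ) (hφc : HasCompactSupport φ) (x : R3) :
    HasGradientAt (φ ⋆[ContinuousLinearMap.lsmul ℝ ℝ] u)
      ((φ ⋆[ContinuousLinearMap.lsmul ℝ ℝ] G) x) x := by
  set ψ : R3 → ℝ := fun y => φ (x - y)
  have hψ : ContDiff ℝ ∞ ψ := hφ.comp (contDiff_const.sub contDiff_id)
  have hψc : HasCompactSupport ψ := hφc.comp_homeomorph (Homeomorph.subLeft x)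
  have hψ' (y v : R3) : fderiv ℝ ψ y (-v) = fderiv ℝ φ (x - y) v := by
    have hcomp := ((hφ.differentiable (by simp) _).hasFDerivAt).comp y
      ((hasFDerivAt_id y).const_sub x)
    simpa [ψ, Function.comp_def] using congrArg (· (-v)) hcomp.fderiv
  have hGint : Integrable fun y => φ (x - y) • G y :=
    (hφc.convolutionExists_left (ContinuousLinearMap.lsmul ℝ ℝ) hφ.continuous
      h.locallyIntegrable_grad x).integrable_swap
  have huint := ((hφc.fderiv (𝕜 := ℝ)).convolutionExists_left
    ((ContinuousLinearMap.lsmul ℝ ℝ).precompL R3) (hφ.continuous_fderiv (by simp))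
    h.locallyIntegrable x).integrable_swap
  have hgrad : InnerProductSpace.toDual ℝ R3 ((φ ⋆[ContinuousLinearMap.lsmul ℝ ℝ] G) x) =
      (fderiv ℝ φ ⋆[(ContinuousLinearMap.lsmul ℝ ℝ).precompL R3] u) x := by
    ext v
    have hweak := h.integral_eq ψ hψ hψc (-v)
    simp only [hψ', inner_neg_right, neg_mul, integral_neg, neg_neg] at hweak
    rw [convolution_lsmul_swap, convolution_eq_swap, ContinuousLinearMap.integral_apply huint,
      InnerProductSpace.toDual_apply_apply, real_inner_comm, ← integral_inner hGint]
    simpa [ContinuousLinearMap.precompL, real_inner_smul_right, real_inner_comm, mul_comm,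
      ψ] using hweak.symm
  rw [hasGradientAt_iff_hasFDerivAt, hgrad]
  exact hφc.hasFDerivAt_convolution_left _ (hφ.of_le (by exact_mod_cast le_top))
    h.locallyIntegrable x

theorem lintegral_enorm_normed_eq_one (φ : ContDiffBump (0 : R3)) :
    ∫⁻ x, ‖φ.normed volume x‖ₑ = 1 := by
  simp_rw [Real.enorm_of_nonneg (φ.nonneg_normed _)]
  rw [← ofReal_integral_eq_lintegral_ofReal φ.integrable_normed
    (.of_forall φ.nonneg_normed), φ.integral_normed, ENNReal.ofReal_one]

theorem lintegral_enorm_convolution_normed_rpow_le {F : Type*} [NormedAddCommGroup F]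
    [NormedSpace ℝ F] [MeasurableSpace F] [OpensMeasurableSpace F] (φ : ContDiffBump (0 : R3))
    {g : R3 → F} (hg : Measurable g) {p : ℝ} (hp : 1 ≤ p) :
    ∫⁻ x, ‖(φ.normed volume ⋆[ContinuousLinearMap.lsmul ℝ ℝ] g) x‖ₑ ^ p ≤
      ∫⁻ x, ‖g x‖ₑ ^ p := by
  calc _ ≤ ∫⁻ x, ((fun y => ‖φ.normed volume y‖ₑ) ⋆ₗ fun y => ‖g y‖ₑ) x ^ p := by
        gcongr with x
        exact enorm_convolution_lsmul_le volume _ g x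
    _ ≤ _ := lintegral_lconvolution_rpow_le φ.continuous_normed.measurable.enorm hg.enorm
        (lintegral_enorm_normed_eq_one φ) hp

namespace HasWeakGradient

variable {u : R3 → ℝ} {G : R3 → R3}

theorem lintegral_mul_enorm_convolution_normed_le (h : HasWeakGradient u G) (hu : Measurable u)
    (hG : Measurable G) {p : ℝ} (hp : 1 ≤ p) (hup : ∫⁻ x, ‖u x‖ₑ ^ p ≠ ⊤) {f : R3 → ℝ≥0∞}
    (hf : Measurable f) (φ : ContDiffBump (0 : R3)) :
    3 * volume (ball (0 : R3) 1) *
        ∫⁻ x, f x * ‖(φ.normed volume ⋆[ContinuousLinearMap.lsmul ℝ ℝ] u) x‖ₑ ≤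
      (∫⁻ x, f x * ((rieszKernel 2 ⋆ₗ rieszKernel 2) ⋆ₗ f) x) ^ (1 / 2 : ℝ) *
        (∫⁻ x, ‖G x‖ₑ ^ 2) ^ (1 / 2 : ℝ) := by
  set w := φ.normed volume ⋆[ContinuousLinearMap.lsmul ℝ ℝ] u
  have hw : ContDiff ℝ 1 w := (φ.hasCompactSupport_normed (μ := volume)).contDiff_convolution_left
    _ φ.contDiff_normed h.locallyIntegrable
  have hwp : ∫⁻ x, ‖w x‖ₑ ^ p ≠ ⊤ :=
    ((lintegral_enorm_convolution_normed_rpow_le φ hu hp).trans_lt hup.lt_top).ne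
  have hgrad (x : R3) : ‖fderiv ℝ w x‖ₑ =
      ‖(φ.normed volume ⋆[ContinuousLinearMap.lsmul ℝ ℝ] G) x‖ₑ := by
    have hx := h.hasGradientAt_convolution (φ.contDiff_normed (μ := volume))
      φ.hasCompactSupport_normed x
    rw [hx.hasFDerivAt.fderiv, LinearIsometryEquiv.enorm_map]
  have hfw : Measurable fun x => f x * ‖w x‖ₑ := hf.mul hw.continuous.enorm.measurable
  have hgradm : Measurable fun x => ‖fderiv ℝ w x‖ₑ :=
    (hw.continuous_fderiv one_ne_zero).enorm.measurable
  calc 3 * volume (ball (0 : R3) 1) * ∫⁻ x, f x * ‖w x‖ₑ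
      = ∫⁻ x, f x * (3 * volume (ball (0 : R3) 1) * ‖w x‖ₑ) := by
        rw [← lintegral_const_mul _ hfw]
        exact lintegral_congr fun x => by ring
    _ ≤ ∫⁻ x, f x * (rieszKernel 2 ⋆ₗ fun y => ‖fderiv ℝ w y‖ₑ) x := by
        gcongr with x
        simpa using enorm_le_lconvolution_rieszKernel_fderiv volume hw (zero_lt_one.trans_le hp)
          hwp x
    _ ≤ (∫⁻ x, f x * ((rieszKernel 2 ⋆ₗ rieszKernel 2) ⋆ₗ f) x) ^ (1 / 2 : ℝ) *
          (∫⁻ x, ‖fderiv ℝ w x‖ₑ ^ 2) ^ (1 / 2 : ℝ) :=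
        lintegral_mul_lconvolution_le_of_even (measurable_rieszKernel 2) hf hgradm
          (rieszKernel_neg 2)
    _ ≤ _ := by
        simp_rw [hgrad]
        gcongr _ * ?_ ^ (1 / 2 : ℝ)
        exact_mod_cast lintegral_enorm_convolution_normed_rpow_le φ hG one_le_two

theorem lintegral_mul_enorm_le (h : HasWeakGradient u G) (hu : Measurable u)
    (hG : Measurable G) {p : ℝ} (hp : 1 ≤ p) (hup : ∫⁻ x, ‖u x‖ₑ ^ p ≠ ⊤) {f : R3 → ℝ≥0∞}
    (hf : Measurable f) (hftop : ∀ x, f x ≠ ⊤) :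
    3 * volume (ball (0 : R3) 1) * ∫⁻ x, f x * ‖u x‖ₑ ≤
      (∫⁻ x, f x * ((rieszKernel 2 ⋆ₗ rieszKernel 2) ⋆ₗ f) x) ^ (1 / 2 : ℝ) *
        (∫⁻ x, ‖G x‖ₑ ^ 2) ^ (1 / 2 : ℝ) := by
  let φ (n : ℕ) : ContDiffBump (0 : R3) :=
    ⟨1 / (n + 1), 2 * (1 / (n + 1)), by positivity,
      by linarith [Nat.one_div_pos_of_nat (α := ℝ) (n := n)]⟩
  have hφ : Tendsto (fun n => (φ n).rOut) atTop (𝓝 0) := by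
    simpa [φ] using (tendsto_one_div_add_atTop_nhds_zero_nat (𝕜 := ℝ)).const_mul 2
  have hlim : ∀ᵐ x, Tendsto (fun n =>
      f x * ‖((φ n).normed volume ⋆[ContinuousLinearMap.lsmul ℝ ℝ] u) x‖ₑ) atTop
      (𝓝 (f x * ‖u x‖ₑ)) := by
    filter_upwards [ContDiffBump.ae_convolution_tendsto_right_of_locallyIntegrable hφ
      (.of_forall fun n => le_rfl) h.locallyIntegrable] with x hx
    exact ENNReal.Tendsto.const_mul hx.enorm (Or.inr (hftop x))
  have hmeas (n : ℕ) : Measurable fun x =>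
      f x * ‖((φ n).normed volume ⋆[ContinuousLinearMap.lsmul ℝ ℝ] u) x‖ₑ :=
    hf.mul ((φ n).hasCompactSupport_normed.continuous_convolution_left _ (φ n).continuous_normed
      h.locallyIntegrable).enorm.measurable
  have hc : 3 * volume (ball (0 : R3) 1) ≠ 0 :=
    mul_ne_zero three_ne_zero (measure_ball_pos volume 0 one_pos).ne'
  have hctop : 3 * volume (ball (0 : R3) 1) ≠ ⊤ :=
    ENNReal.mul_ne_top (by simp) measure_ball_lt_top.ne
  rw [mul_comm, ← ENNReal.le_div_iff_mul_le (Or.inl hc) (Or.inl hctop)]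
  calc ∫⁻ x, f x * ‖u x‖ₑ = ∫⁻ x, liminf (fun n =>
        f x * ‖((φ n).normed volume ⋆[ContinuousLinearMap.lsmul ℝ ℝ] u) x‖ₑ) atTop :=
        lintegral_congr_ae (hlim.mono fun x hx => hx.liminf_eq.symm)
    _ ≤ liminf (fun n => ∫⁻ x,
        f x * ‖((φ n).normed volume ⋆[ContinuousLinearMap.lsmul ℝ ℝ] u) x‖ₑ) atTop :=
        lintegral_liminf_le hmeas
    _ ≤ _ := by
        refine liminf_le_of_le (by isBoundedDefault) fun b hb => ?_
        obtain ⟨n, hn⟩ := hb.exists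
        refine hn.trans ?_
        rw [ENNReal.le_div_iff_mul_le (Or.inl hc) (Or.inl hctop), mul_comm]
        exact h.lintegral_mul_enorm_convolution_normed_le hu hG hp hup hf (φ n)

end HasWeakGradient

theorem exists_lintegral_mul_lconvolution_le_coulombEnergy :
    ∃ C : ℝ≥0∞, C ≠ ⊤ ∧ ∀ u : R3 → ℝ,
      ∫⁻ x, ‖u x‖ₑ ^ 2 * ((rieszKernel 2 ⋆ₗ rieszKernel 2) ⋆ₗ fun y => ‖u y‖ₑ ^ 2) x ≤
        C * coulombEnergy u := by
  obtain ⟨C, hC, hle⟩ := exists_lconvolution_rieszKernel_le (E := R3) volume (a := 2) (b := 2)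
    (by simp) (by simp) (by simp)
  simp only [finrank_euclideanSpace_fin] at hle
  refine ⟨C, hC, fun u => ?_⟩
  rw [coulombEnergy_eq_lintegral_mul_lconvolution, ← lintegral_const_mul' _ _ hC]
  refine lintegral_mono fun x => ?_
  calc ‖u x‖ₑ ^ 2 * ((rieszKernel 2 ⋆ₗ rieszKernel 2) ⋆ₗ fun y => ‖u y‖ₑ ^ 2) x
      ≤ ‖u x‖ₑ ^ 2 * ∫⁻ y, C * (rieszKernel 1 y * ‖u (-y + x)‖ₑ ^ 2) := by
        gcongr
        refine lintegral_mono fun y => ?_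
        rw [← mul_assoc]
        gcongr
        exact hle y
    _ = _ := by
        rw [lintegral_const_mul' _ _ hC, mul_left_comm]
        rfl

theorem HasWeakGradient.lintegral_enorm_cube_lt_top {u : R3 → ℝ} {G : R3 → R3}
    (h : HasWeakGradient u G) (hu : Measurable u) (hG : Measurable G) {p : ℝ} (hp : 1 ≤ p)
    (hup : ∫⁻ x, ‖u x‖ₑ ^ p ≠ ⊤) (hG2 : ∫⁻ x, ‖G x‖ₑ ^ 2 ≠ ⊤) (hE : coulombEnergy u ≠ ⊤) :
    ∫⁻ x, ‖u x‖ₑ ^ 3 < ⊤ := by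
  obtain ⟨C, hC, hle⟩ := exists_lintegral_mul_lconvolution_le_coulombEnergy
  have hpot := ((hle u).trans_lt (ENNReal.mul_lt_top hC.lt_top hE.lt_top)).ne
  have hbound := h.lintegral_mul_enorm_le hu hG hp hup (f := fun x => ‖u x‖ₑ ^ 2) (by fun_prop)
    (fun x => by finiteness)
  have hc : 3 * volume (ball (0 : R3) 1) ≠ 0 :=
    mul_ne_zero three_ne_zero (measure_ball_pos volume 0 one_pos).ne'
  simp_rw [pow_succ (_ : ℝ≥0∞) 2]
  refine ENNReal.lt_top_of_mul_ne_top_right (ne_top_of_le_ne_top ?_ hbound) hc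
  finiteness

theorem HasWeakGradient.congr_ae {u u' : R3 → ℝ} {G G' : R3 → R3} (h : HasWeakGradient u G)
    (hu : u =ᵐ[volume] u') (hG : G =ᵐ[volume] G') : HasWeakGradient u' G' where
  locallyIntegrable := h.locallyIntegrable.congr hu
  locallyIntegrable_grad := h.locallyIntegrable_grad.congr hG
  integral_eq φ hφ hφc v := by
    have hleft : ∫ x, u' x * fderiv ℝ φ x v = ∫ x, u x * fderiv ℝ φ x v :=
      integral_congr_ae (hu.mono fun x hx => by simp only [hx])
    have hright : ∫ x, inner ℝ (G' x) v * φ x = ∫ x, inner ℝ (G x) v * φ x :=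
      integral_congr_ae (hG.mono fun x hx => by simp only [hx])
    rw [hleft, hright, h.integral_eq φ hφ hφc v]

theorem coulombEnergy_congr_ae {u u' : R3 → ℝ} (hu : u =ᵐ[volume] u') :
    coulombEnergy u = coulombEnergy u' :=
  lintegral_congr_ae <| hu.mono fun x hx => lintegral_congr_ae <| hu.mono fun y hy => by
    simp only [hx, hy]

theorem memLp_three_of_mem_spaceE {u : R3 → ℝ} (hu : u ∈ spaceE) : MemLp u 3 volume := by
  obtain ⟨⟨hu6, G, hG, hG2⟩, hE⟩ := hu
  have hum := hu6.aestronglyMeasurable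
  have hGm := hG2.aestronglyMeasurable
  have hu6' : ∫⁻ x, ‖hum.mk u x‖ₑ ^ (6 : ℝ) ≠ ⊤ := by
    simpa using (lintegral_rpow_enorm_lt_top_of_eLpNorm_lt_top (by simp) (by simp)
      (hu6.ae_eq hum.ae_eq_mk).2).ne
  have hG2' : ∫⁻ x, ‖hGm.mk G x‖ₑ ^ 2 ≠ ⊤ := by
    simpa using (lintegral_rpow_enorm_lt_top_of_eLpNorm_lt_top (by simp) (by simp)
      (hG2.ae_eq hGm.ae_eq_mk).2).ne
  have hcube := (hG.congr_ae hum.ae_eq_mk hGm.ae_eq_mk).lintegral_enorm_cube_lt_top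
    hum.measurable_mk hGm.measurable_mk (by norm_num) hu6' hG2'
    (coulombEnergy_congr_ae hum.ae_eq_mk ▸ hE.ne)
  refine (memLp_congr_ae hum.ae_eq_mk).mpr ⟨hum.stronglyMeasurable_mk.aestronglyMeasurable, ?_⟩
  rw [eLpNorm_lt_top_iff_lintegral_rpow_enorm_lt_top (by simp) (by simp)]
  simpa using hcube

theorem memLp_of_exponent_between {α F : Type*} [MeasurableSpace α] {μ : Measure α}
    [NormedAddCommGroup F] {f : α → F} {p q r : ℝ≥0∞} (hp : MemLp f p μ) (hr : MemLp f r μ)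
    (hp0 : p ≠ 0) (hrtop : r ≠ ⊤) (hpq : p ≤ q) (hqr : q ≤ r) : MemLp f q μ := by
  have hq0 : q ≠ 0 := ((pos_iff_ne_zero.2 hp0).trans_le hpq).ne'
  have hqtop : q ≠ ⊤ := ne_top_of_le_ne_top hrtop hqr
  refine ⟨hp.1, ?_⟩
  rw [eLpNorm_lt_top_iff_lintegral_rpow_enorm_lt_top hq0 hqtop]
  calc ∫⁻ x, ‖f x‖ₑ ^ q.toReal ∂μ
      ≤ ∫⁻ x, ‖f x‖ₑ ^ p.toReal + ‖f x‖ₑ ^ r.toReal ∂μ := by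
        refine lintegral_mono fun x => ?_
        rcases le_total ‖f x‖ₑ 1 with h | h
        · exact le_add_right (ENNReal.rpow_le_rpow_of_exponent_ge h (ENNReal.toReal_mono hqtop hpq))
        · exact le_add_left (ENNReal.rpow_le_rpow_of_exponent_le h (ENNReal.toReal_mono hrtop hqr))
    _ < ⊤ := by
        rw [lintegral_add_left' (hp.1.enorm.pow_const _)]
        exact ENNReal.add_lt_top.2
          ⟨lintegral_rpow_enorm_lt_top_of_eLpNorm_lt_top hp0 (ne_top_of_le_ne_top hqtop hpq) hp.2,
            lintegral_rpow_enorm_lt_top_of_eLpNorm_lt_top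
              (pos_iff_ne_zero.1 ((pos_iff_ne_zero.2 hq0).trans_le hqr)) hrtop hr.2⟩

theorem spaceE_subset_spaceLp {p : ℝ≥0∞} (hp3 : 3 ≤ p) (hp6 : p ≤ 6) : spaceE ⊆ spaceLp p :=
  fun _ hu => memLp_of_exponent_between (memLp_three_of_mem_spaceE hu) hu.1.1 (by simp) (by simp)
    hp3 hp6

section ScaledBump

variable {E : Type*} [NormedAddCommGroup E] [NormedSpace ℝ E] [HasContDiffBump E]

/-- The bump at scale `r` about `c` of height `r⁻²`: it equals `r⁻²` on the ball of radius `r` and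
vanishes outside the ball of radius `2 r`. -/
noncomputable def scaledBump (r : ℝ) (c x : E) : ℝ :=
  (r ^ 2)⁻¹ * (⟨1, 2, one_pos, one_lt_two⟩ : ContDiffBump (0 : E)) (r⁻¹ • (x - c))

theorem contDiff_scaledBump (r : ℝ) (c : E) : ContDiff ℝ ∞ (scaledBump r c) :=
  contDiff_const.mul ((ContDiffBump.contDiff _).comp (by fun_prop))

theorem norm_scaledBump_le (r : ℝ) (c x : E) : ‖scaledBump r c x‖ ≤ (r ^ 2)⁻¹ := by
  rw [scaledBump, norm_mul, Real.norm_of_nonneg (ContDiffBump.nonneg _),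
    Real.norm_of_nonneg (by positivity)]
  exact mul_le_of_le_one_right (by positivity) (ContDiffBump.le_one _)

theorem scaledBump_eq_of_mem {r : ℝ} (hr : 0 < r) {c x : E} (hx : x ∈ closedBall c r) :
    scaledBump r c x = (r ^ 2)⁻¹ := by
  rw [scaledBump, ContDiffBump.one_of_mem_closedBall, mul_one]
  rw [mem_closedBall_zero_iff, norm_smul, norm_inv, Real.norm_of_nonneg hr.le,
    inv_mul_le_iff₀ hr, mul_one]
  exact mem_closedBall_iff_norm.1 hx

theorem scaledBump_eq_zero {r : ℝ} (hr : 0 < r) {c x : E} (hx : x ∉ closedBall c (2 * r)) :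
    scaledBump r c x = 0 := by
  rw [scaledBump, ContDiffBump.zero_of_le_dist, mul_zero]
  rw [mem_closedBall_iff_norm, not_le] at hx
  rw [dist_zero_right, norm_smul, norm_inv, Real.norm_of_nonneg hr.le, le_inv_mul_iff₀ hr]
  linarith

theorem fderiv_scaledBump_eq_zero {r : ℝ} (hr : 0 < r) {c x : E}
    (hx : x ∉ closedBall c (2 * r)) : fderiv ℝ (scaledBump r c) x = 0 := by
  have hzero : scaledBump r c =ᶠ[𝓝 x] fun _ => 0 := by
    filter_upwards [isClosed_closedBall.isOpen_compl.mem_nhds hx] with y hy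
    exact scaledBump_eq_zero hr hy
  rw [hzero.fderiv_eq, fderiv_const_apply]

theorem exists_norm_fderiv_scaledBump_le [FiniteDimensional ℝ E] :
    ∃ K : ℝ, ∀ r : ℝ, 0 < r → ∀ c x : E, ‖fderiv ℝ (scaledBump r c) x‖ ≤ K * (r ^ 3)⁻¹ := by
  let ψ : ContDiffBump (0 : E) := ⟨1, 2, one_pos, one_lt_two⟩
  have hψ : ContDiff ℝ 1 ψ := ψ.contDiff
  obtain ⟨K, hK⟩ := (hψ.continuous_fderiv one_ne_zero).bounded_above_of_compact_support
    (ψ.hasCompactSupport.fderiv (𝕜 := ℝ))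
  refine ⟨K, fun r hr c x => ?_⟩
  have hinner : HasFDerivAt (fun y : E => r⁻¹ • (y - c)) (r⁻¹ • ContinuousLinearMap.id ℝ E) x :=
    ((hasFDerivAt_id x).sub_const c).const_smul r⁻¹
  have hbump : HasFDerivAt (scaledBump r c)
      ((r ^ 2)⁻¹ • (fderiv ℝ ψ (r⁻¹ • (x - c))).comp (r⁻¹ • ContinuousLinearMap.id ℝ E)) x :=
    ((hψ.differentiable one_ne_zero _).hasFDerivAt.comp x hinner).const_mul (r ^ 2)⁻¹
  rw [hbump.fderiv, ContinuousLinearMap.comp_smul, ContinuousLinearMap.comp_id, smul_smul,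
    norm_smul, Real.norm_of_nonneg (by positivity)]
  calc (r ^ 2)⁻¹ * r⁻¹ * ‖fderiv ℝ ψ (r⁻¹ • (x - c))‖
      ≤ (r ^ 2)⁻¹ * r⁻¹ * K := by gcongr; exact hK _
    _ = K * (r ^ 3)⁻¹ := by rw [← mul_inv, ← pow_succ, mul_comm]

end ScaledBump

section BumpSeries

/-- The centre of the `n`-th bump of the counterexample, far out on the first axis. -/
noncomputable def farCenter (n : ℕ) : R3 := EuclideanSpace.single 0 (8 * 4 ^ n)

/-- A closed ball containing the support of the `n`-th bump. -/
noncomputable def supportBall (R : ℕ → ℝ) (n : ℕ) : Set R3 := closedBall (farCenter n) (2 * R n)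

/-- The function of the counterexample: a superposition of bumps of radius `R n` and height
`(R n)⁻²` which are far apart from each other. -/
noncomputable def bumpSeries (R : ℕ → ℝ) (x : R3) : ℝ := ∑' n, scaledBump (R n) (farCenter n) x

/-- The step function with value `(R n)⁻ᵏ` on the `n`-th support ball, used to dominate powers of
`bumpSeries R` and of its gradient. -/
noncomputable def stepSeries (R : ℕ → ℝ) (k : ℕ) (x : R3) : ℝ≥0∞ :=
  ∑' n, (supportBall R n).indicator (fun _ => ENNReal.ofReal (R n ^ k)⁻¹) x

variable {R : ℕ → ℝ}

theorem two_pow_mul_two_pow_le_dist (hR : ∀ n, R n ≤ n + 1) {n m : ℕ} (hnm : n ≠ m) {x y : R3}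
    (hx : x ∈ supportBall R n) (hy : y ∈ supportBall R m) : (2 : ℝ) ^ n * 2 ^ m ≤ dist x y := by
  wlog hlt : m < n generalizing n m x y
  · rw [mul_comm, dist_comm]
    exact this hnm.symm hy hx (lt_of_le_of_ne (not_lt.mp hlt) hnm)
  have hsucc (k : ℕ) : (k : ℝ) + 1 ≤ 4 ^ k := by
    exact_mod_cast (Nat.lt_pow_self (by norm_num) : k < 4 ^ k)
  have hstep : (4 : ℝ) * 4 ^ m ≤ 4 ^ n := by
    rw [← pow_succ']
    exact pow_le_pow_right₀ (by norm_num) hlt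
  have hprod : (2 : ℝ) ^ n * 2 ^ m ≤ 4 ^ n := by
    calc (2 : ℝ) ^ n * 2 ^ m ≤ 2 ^ n * 2 ^ n := by gcongr; norm_num
      _ = 4 ^ n := by rw [← mul_pow]; norm_num
  have hcenter : 8 * (4 : ℝ) ^ n - 8 * 4 ^ m ≤ dist (farCenter n) (farCenter m) := by
    exact (le_abs_self _).trans_eq (PiLp.dist_single_same 2 (fun _ : Fin 3 => ℝ) 0 _ _).symm
  have htri : dist (farCenter n) (farCenter m) ≤
      dist x (farCenter n) + dist x y + dist y (farCenter m) := by
    rw [dist_comm x (farCenter n)]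
    exact dist_triangle4 _ _ _ _
  have hpos : (0 : ℝ) < 4 ^ m := by positivity
  linarith [hR n, hR m, hsucc n, hsucc m, mem_closedBall.1 hx, mem_closedBall.1 hy]

theorem one_le_dist_of_mem_supportBall (hR : ∀ n, R n ≤ n + 1) {n m : ℕ} (hnm : n ≠ m)
    {x y : R3} (hx : x ∈ supportBall R n) (hy : y ∈ supportBall R m) : 1 ≤ dist x y :=
  (one_le_mul_of_one_le_of_one_le (one_le_pow₀ one_le_two) (one_le_pow₀ one_le_two)).trans
    (two_pow_mul_two_pow_le_dist hR hnm hx hy)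

theorem pairwise_disjoint_supportBall (hR : ∀ n, R n ≤ n + 1) :
    Pairwise (Function.onFun Disjoint (supportBall R)) := fun n m hnm =>
  disjoint_left.2 fun x hx hx' => by
    have := one_le_dist_of_mem_supportBall hR hnm hx hx'
    rw [dist_self] at this
    linarith

theorem bumpSeries_eq_of_dist_lt (h0 : ∀ n, 0 < R n) (hR : ∀ n, R n ≤ n + 1) {n : ℕ} {x y : R3}
    (hy : y ∈ supportBall R n) (hxy : dist x y < 1) :
    bumpSeries R x = scaledBump (R n) (farCenter n) x :=
  tsum_eq_single n fun m hm => scaledBump_eq_zero (h0 m) fun hx =>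
    hxy.not_ge (one_le_dist_of_mem_supportBall hR hm hx hy)

theorem exists_bumpSeries_eventuallyEq (h0 : ∀ n, 0 < R n) (hR : ∀ n, R n ≤ n + 1) (x : R3) :
    ∃ n, bumpSeries R =ᶠ[𝓝 x] scaledBump (R n) (farCenter n) := by
  have hball : ball x (1 / 2) ∈ 𝓝 x := ball_mem_nhds _ (by norm_num)
  by_cases h : ∃ n, ∃ y ∈ ball x (1 / 2), y ∈ supportBall R n
  · obtain ⟨n, y, hy, hyn⟩ := h
    refine ⟨n, ?_⟩
    filter_upwards [hball] with z hz
    refine bumpSeries_eq_of_dist_lt h0 hR hyn ?_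
    linarith [dist_triangle_right z y x, mem_ball.1 hy, mem_ball.1 hz]
  · push Not at h
    refine ⟨0, ?_⟩
    filter_upwards [hball] with z hz
    exact tsum_eq_single 0 fun m _ => scaledBump_eq_zero (h0 m) (h m z hz)

theorem contDiff_bumpSeries (h0 : ∀ n, 0 < R n) (hR : ∀ n, R n ≤ n + 1) :
    ContDiff ℝ ∞ (bumpSeries R) :=
  contDiff_iff_contDiffAt.2 fun x => by
    obtain ⟨n, hn⟩ := exists_bumpSeries_eventuallyEq h0 hR x
    exact (contDiff_scaledBump _ _).contDiffAt.congr_of_eventuallyEq hn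

theorem measurableSet_supportBall (R : ℕ → ℝ) (n : ℕ) : MeasurableSet (supportBall R n) :=
  isClosed_closedBall.measurableSet

theorem measurable_stepSeries (R : ℕ → ℝ) (k : ℕ) : Measurable (stepSeries R k) :=
  .tsum fun n => measurable_const.indicator (measurableSet_supportBall R n)

theorem volume_supportBall {n : ℕ} (h0 : 0 < R n) :
    volume (supportBall R n) = ENNReal.ofReal (8 * R n ^ 3) * volume (ball (0 : R3) 1) := by
  rw [supportBall, Measure.addHaar_closedBall _ _ (by positivity), finrank_euclideanSpace_fin,
    mul_pow]
  norm_num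

theorem lintegral_mul_stepSeries {f : R3 → ℝ≥0∞} (hf : Measurable f) (k : ℕ) :
    ∫⁻ x, f x * stepSeries R k x =
      ∑' n, ENNReal.ofReal (R n ^ k)⁻¹ * ∫⁻ x in supportBall R n, f x := by
  have hterm (n : ℕ) : Measurable fun x =>
      f x * (supportBall R n).indicator (fun _ => ENNReal.ofReal (R n ^ k)⁻¹) x :=
    hf.mul (measurable_const.indicator (measurableSet_supportBall R n))
  simp only [stepSeries, ← ENNReal.tsum_mul_left]
  rw [lintegral_tsum fun n => (hterm n).aemeasurable]
  refine tsum_congr fun n => ?_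
  rw [← lintegral_const_mul _ hf, ← lintegral_indicator (measurableSet_supportBall R n)]
  refine lintegral_congr fun x => ?_
  by_cases hx : x ∈ supportBall R n <;> simp [hx, mul_comm]

theorem lintegral_stepSeries_lt_top (h1 : ∀ n, 1 ≤ R n) (hsum : Summable fun n => (R n ^ 3)⁻¹)
    {k : ℕ} (hk : 6 ≤ k) : ∫⁻ x, stepSeries R k x < ⊤ := by
  have h0 (n : ℕ) : 0 < R n := one_pos.trans_le (h1 n)
  have hle (n : ℕ) : (R n ^ k)⁻¹ * (8 * R n ^ 3) ≤ 8 * (R n ^ 3)⁻¹ := by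
    have := h0 n
    calc (R n ^ k)⁻¹ * (8 * R n ^ 3) ≤ (R n ^ 6)⁻¹ * (8 * R n ^ 3) := by
          gcongr
          exact h1 n
      _ = 8 * (R n ^ 3)⁻¹ := by field_simp
  calc ∫⁻ x, stepSeries R k x
      = ∑' n, ENNReal.ofReal (R n ^ k)⁻¹ * volume (supportBall R n) := by
        simpa using lintegral_mul_stepSeries (R := R) measurable_const k (f := fun _ => 1)
    _ ≤ ∑' n, ENNReal.ofReal (8 * (R n ^ 3)⁻¹) * volume (ball (0 : R3) 1) := by
        refine ENNReal.tsum_le_tsum fun n => ?_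
        have := h0 n
        rw [volume_supportBall (h0 n), ← mul_assoc, ← ENNReal.ofReal_mul (by positivity)]
        gcongr ENNReal.ofReal ?_ * _
        exact hle n
    _ < ⊤ := by
        rw [ENNReal.tsum_mul_right]
        exact ENNReal.mul_lt_top (hsum.mul_left 8).tsum_ofReal_lt_top measure_ball_lt_top

theorem enorm_pow_le_stepSeries {F : Type*} [NormedAddCommGroup F] {n j k : ℕ} {K : ℝ} {x : R3}
    {v : F} (hn : 0 ≤ R n) (hj : j ≠ 0) (hin : ‖v‖ ≤ K * (R n ^ k)⁻¹)
    (hout : x ∉ supportBall R n → v = 0) :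
    ‖v‖ₑ ^ j ≤ ENNReal.ofReal K ^ j * stepSeries R (k * j) x := by
  by_cases hx : x ∈ supportBall R n
  · calc ‖v‖ₑ ^ j ≤ ENNReal.ofReal (K * (R n ^ k)⁻¹) ^ j := by
          gcongr
          rw [← ofReal_norm]
          exact ENNReal.ofReal_le_ofReal hin
      _ = ENNReal.ofReal K ^ j * (supportBall R n).indicator
            (fun _ => ENNReal.ofReal (R n ^ (k * j))⁻¹) x := by
          rw [indicator_of_mem hx, ENNReal.ofReal_mul' (by positivity), mul_pow,
            ← ENNReal.ofReal_pow (p := (R n ^ k)⁻¹) (by positivity), inv_pow, ← pow_mul]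
      _ ≤ _ := by
          gcongr
          exact ENNReal.le_tsum n
  · simp [hout hx, hj]

theorem enorm_bumpSeries_pow_le (h0 : ∀ n, 0 < R n) (hR : ∀ n, R n ≤ n + 1) {j : ℕ} (hj : j ≠ 0)
    (x : R3) : ‖bumpSeries R x‖ₑ ^ j ≤ stepSeries R (2 * j) x := by
  obtain ⟨n, hn⟩ := exists_bumpSeries_eventuallyEq h0 hR x
  rw [hn.eq_of_nhds]
  simpa using enorm_pow_le_stepSeries (K := 1) (h0 n).le hj
    (by simpa using norm_scaledBump_le (R n) (farCenter n) x) (scaledBump_eq_zero (h0 n))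

theorem exists_enorm_fderiv_bumpSeries_sq_le (h0 : ∀ n, 0 < R n) (hR : ∀ n, R n ≤ n + 1) :
    ∃ K : ℝ, ∀ x, ‖fderiv ℝ (bumpSeries R) x‖ₑ ^ 2 ≤ ENNReal.ofReal K ^ 2 * stepSeries R 6 x := by
  obtain ⟨K, hK⟩ := exists_norm_fderiv_scaledBump_le (E := R3)
  refine ⟨K, fun x => ?_⟩
  obtain ⟨n, hn⟩ := exists_bumpSeries_eventuallyEq h0 hR x
  rw [hn.fderiv_eq]
  exact enorm_pow_le_stepSeries (h0 n).le two_ne_zero (hK _ (h0 n) _ _)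
    (fderiv_scaledBump_eq_zero (h0 n))

theorem HasWeakGradient.of_contDiff {u : R3 → ℝ} (hu : ContDiff ℝ 1 u) :
    HasWeakGradient u (gradient u) := by
  have hfd := hu.continuous_fderiv one_ne_zero
  refine ⟨hu.continuous.locallyIntegrable,
    ((LinearIsometryEquiv.continuous _).comp hfd).locallyIntegrable, fun φ hφ hφc v => ?_⟩
  simp only [gradient, InnerProductSpace.toDual_symm_apply]
  have hφd : Continuous fun x => fderiv ℝ φ x v :=
    (hφ.continuous_fderiv (by simp)).clm_apply continuous_const
  refine integral_mul_fderiv_eq_neg_fderiv_mul_of_integrable ?_ ?_ ?_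
    (fun x _ => hu.differentiable one_ne_zero x) (fun x _ => hφ.differentiable (by simp) x)
  · exact ((hfd.clm_apply continuous_const).mul hφ.continuous).integrable_of_hasCompactSupport
      hφc.mul_left
  · exact (hu.continuous.mul hφd).integrable_of_hasCompactSupport
      (hφc.fderiv_apply (𝕜 := ℝ) v).mul_left
  · exact (hu.continuous.mul hφ.continuous).integrable_of_hasCompactSupport hφc.mul_left

theorem bumpSeries_mem_spaceD12 (h1 : ∀ n, 1 ≤ R n) (hR : ∀ n, R n ≤ n + 1)
    (hsum : Summable fun n => (R n ^ 3)⁻¹) : bumpSeries R ∈ spaceD12 := by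
  have h0 (n : ℕ) : 0 < R n := one_pos.trans_le (h1 n)
  have hu : ContDiff ℝ 1 (bumpSeries R) :=
    (contDiff_bumpSeries h0 hR).of_le (by exact_mod_cast le_top)
  obtain ⟨K, hK⟩ := exists_enorm_fderiv_bumpSeries_sq_le h0 hR
  have hsix : ∫⁻ x, ‖bumpSeries R x‖ₑ ^ 6 < ⊤ :=
    (lintegral_mono (enorm_bumpSeries_pow_le h0 hR (by norm_num))).trans_lt
      (lintegral_stepSeries_lt_top h1 hsum (by norm_num))
  have hgrad : ∫⁻ x, ‖gradient (bumpSeries R) x‖ₑ ^ 2 < ⊤ := by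
    simp only [gradient, LinearIsometryEquiv.enorm_map]
    refine (lintegral_mono hK).trans_lt ?_
    rw [lintegral_const_mul _ (measurable_stepSeries R 6)]
    exact ENNReal.mul_lt_top (by finiteness) (lintegral_stepSeries_lt_top h1 hsum le_rfl)
  refine ⟨⟨hu.continuous.aestronglyMeasurable, ?_⟩, gradient (bumpSeries R), .of_contDiff hu,
    ((LinearIsometryEquiv.continuous _).comp
      (hu.continuous_fderiv one_ne_zero)).aestronglyMeasurable, ?_⟩
  · rw [eLpNorm_lt_top_iff_lintegral_rpow_enorm_lt_top (by simp) (by simp)]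
    simpa using hsix
  · rw [eLpNorm_lt_top_iff_lintegral_rpow_enorm_lt_top (by simp) (by simp)]
    simpa using hgrad

theorem setLIntegral_supportBall_rieszKernel_self_le {n : ℕ} (hn : 0 < R n) {x : R3}
    (hx : x ∈ supportBall R n) :
    ∫⁻ y in supportBall R n, rieszKernel 1 (-y + x) ≤
      ENNReal.ofReal (75 * R n ^ 2) * volume (ball (0 : R3) 1) := by
  have hsub : supportBall R n ⊆ ball x (5 * R n) := fun y hy => by
    rw [mem_ball]
    linarith [dist_triangle_right y x (farCenter n), mem_closedBall.1 hx, mem_closedBall.1 hy]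
  have hball (y : R3) : (ball x (5 * R n)).indicator (fun y => rieszKernel 1 (-y + x)) y =
      (ball (0 : R3) (5 * R n)).indicator (rieszKernel 1) (x - y) := by
    simp only [indicator, mem_ball_iff_norm', zero_sub, norm_neg, neg_add_eq_sub]
  calc ∫⁻ y in supportBall R n, rieszKernel 1 (-y + x)
      ≤ ∫⁻ y in ball x (5 * R n), rieszKernel 1 (-y + x) := lintegral_mono_set hsub
    _ = ∫⁻ z in ball (0 : R3) (5 * R n), rieszKernel 1 z := by
        rw [← lintegral_indicator measurableSet_ball, ← lintegral_indicator measurableSet_ball,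
          lintegral_congr hball, lintegral_sub_left_eq_self]
    _ ≤ 3 * volume (ball (0 : R3) 1) * ENNReal.ofReal (5 * R n) ^ 2 := by
        simpa only [finrank_euclideanSpace_fin, Nat.cast_ofNat, Nat.reduceSub] using
          setLIntegral_ball_rieszKernel_le volume (E := R3) (m := 1) (by simp) (5 * R n)
    _ = _ := by
        have : ENNReal.ofReal (75 * R n ^ 2) = 3 * ENNReal.ofReal (5 * R n) ^ 2 := by
          rw [← ENNReal.ofReal_pow (by positivity), ← ENNReal.ofReal_ofNat 3,
            ← ENNReal.ofReal_mul zero_le_three]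
          ring_nf
        rw [this, mul_right_comm]

theorem setLIntegral_supportBall_rieszKernel_of_ne_le (h0 : ∀ n, 0 < R n)
    (hR : ∀ n, R n ≤ n + 1) {n m : ℕ} (hnm : n ≠ m) {x : R3} (hx : x ∈ supportBall R n) :
    ∫⁻ y in supportBall R m, rieszKernel 1 (-y + x) ≤
      ENNReal.ofReal (8 * R m ^ 3 * ((1 / 2) ^ n * (1 / 2) ^ m)) * volume (ball (0 : R3) 1) := by
  have hfar : ∀ y ∈ supportBall R m,
      rieszKernel 1 (-y + x) ≤ ENNReal.ofReal ((1 / 2) ^ n * (1 / 2) ^ m) := fun y hy => by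
    have hdist : (2 : ℝ) ^ n * 2 ^ m ≤ ‖-y + x‖ := by
      rw [neg_add_eq_sub, ← dist_eq_norm]
      exact two_pow_mul_two_pow_le_dist hR hnm hx hy
    refine (rieszKernel_le_of_le_norm 1 hdist).trans_eq ?_
    rw [pow_one, ← ENNReal.ofReal_inv_of_pos (by positivity), mul_inv, one_div, inv_pow, inv_pow]
  have := h0 m
  calc ∫⁻ y in supportBall R m, rieszKernel 1 (-y + x)
      ≤ ∫⁻ _ in supportBall R m, ENNReal.ofReal ((1 / 2) ^ n * (1 / 2) ^ m) :=
        setLIntegral_mono' (measurableSet_supportBall R m) hfar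
    _ = _ := by
        rw [setLIntegral_const, volume_supportBall this, ← mul_assoc,
          ← ENNReal.ofReal_mul (by positivity), mul_comm (8 * _)]

theorem mul_setLIntegral_supportBall_rieszKernel_le (h1 : ∀ n, 1 ≤ R n)
    (hR : ∀ n, R n ≤ n + 1) {n : ℕ} {x : R3} (hx : x ∈ supportBall R n) (m : ℕ) :
    ENNReal.ofReal (R m ^ 4)⁻¹ * ∫⁻ y in supportBall R m, rieszKernel 1 (-y + x) ≤
      ((if m = n then ENNReal.ofReal (75 * (R n ^ 2)⁻¹) else 0) +
        ENNReal.ofReal (8 * (1 / 2) ^ n * (1 / 2) ^ m)) * volume (ball (0 : R3) 1) := by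
  have h0 (k : ℕ) : 0 < R k := one_pos.trans_le (h1 k)
  have hm := h0 m
  rcases eq_or_ne m n with rfl | hmn
  · rw [if_pos rfl]
    calc _ ≤ ENNReal.ofReal (R m ^ 4)⁻¹ *
          (ENNReal.ofReal (75 * R m ^ 2) * volume (ball (0 : R3) 1)) := by
          gcongr
          exact setLIntegral_supportBall_rieszKernel_self_le hm hx
      _ = ENNReal.ofReal (75 * (R m ^ 2)⁻¹) * volume (ball (0 : R3) 1) := by
          rw [← mul_assoc, ← ENNReal.ofReal_mul (by positivity)]
          congr 2
          field_simp
      _ ≤ _ := by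
          gcongr
          exact le_self_add
  · rw [if_neg hmn, zero_add]
    calc _ ≤ ENNReal.ofReal (R m ^ 4)⁻¹ *
          (ENNReal.ofReal (8 * R m ^ 3 * ((1 / 2) ^ n * (1 / 2) ^ m)) *
            volume (ball (0 : R3) 1)) := by
          gcongr
          exact setLIntegral_supportBall_rieszKernel_of_ne_le h0 hR hmn.symm hx
      _ = ENNReal.ofReal ((R m)⁻¹ * (8 * (1 / 2) ^ n * (1 / 2) ^ m)) *
            volume (ball (0 : R3) 1) := by
          rw [← mul_assoc, ← ENNReal.ofReal_mul (by positivity)]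
          congr 2
          field_simp
      _ ≤ _ := by
          gcongr ENNReal.ofReal ?_ * _
          exact mul_le_of_le_one_left (by positivity) (inv_le_one_of_one_le₀ (h1 m))

theorem lconvolution_rieszKernel_stepSeries_le (h1 : ∀ n, 1 ≤ R n) (hR : ∀ n, R n ≤ n + 1)
    {n : ℕ} {x : R3} (hx : x ∈ supportBall R n) :
    (rieszKernel 1 ⋆ₗ stepSeries R 4) x ≤
      ENNReal.ofReal (75 * (R n ^ 2)⁻¹ + 16 * (1 / 2) ^ n) * volume (ball (0 : R3) 1) := by
  have hgeom : ∑' m : ℕ, ENNReal.ofReal (8 * (1 / 2) ^ n * (1 / 2) ^ m) =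
      ENNReal.ofReal (16 * (1 / 2) ^ n) := by
    rw [← ENNReal.ofReal_tsum_of_nonneg (fun m => by positivity)
      (summable_geometric_two.mul_left _), tsum_mul_left, tsum_geometric_two]
    ring_nf
  have hn := one_pos.trans_le (h1 n)
  calc (rieszKernel 1 ⋆ₗ stepSeries R 4) x
      = ∫⁻ y, rieszKernel 1 (-y + x) * stepSeries R 4 y := by
        rw [lconvolution_comm, lconvolution_def]
        exact lintegral_congr fun y => mul_comm _ _
    _ = ∑' m, ENNReal.ofReal (R m ^ 4)⁻¹ * ∫⁻ y in supportBall R m, rieszKernel 1 (-y + x) :=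
        lintegral_mul_stepSeries (by fun_prop) 4
    _ ≤ ∑' m, ((if m = n then ENNReal.ofReal (75 * (R n ^ 2)⁻¹) else 0) +
          ENNReal.ofReal (8 * (1 / 2) ^ n * (1 / 2) ^ m)) * volume (ball (0 : R3) 1) :=
        ENNReal.tsum_le_tsum (mul_setLIntegral_supportBall_rieszKernel_le h1 hR hx)
    _ = _ := by
        rw [ENNReal.tsum_mul_right, ENNReal.tsum_add, tsum_ite_eq, hgeom,
          ENNReal.ofReal_add (by positivity) (by positivity)]

theorem mul_setLIntegral_supportBall_lconvolution_le (h1 : ∀ n, 1 ≤ R n)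
    (hR : ∀ n, R n ≤ n + 1) (n : ℕ) :
    ENNReal.ofReal (R n ^ 4)⁻¹ *
        ∫⁻ x in supportBall R n, (rieszKernel 1 ⋆ₗ stepSeries R 4) x ≤
      ENNReal.ofReal (600 * (R n ^ 3)⁻¹ + 128 * (1 / 2) ^ n) *
        volume (ball (0 : R3) 1) ^ 2 := by
  set V := volume (ball (0 : R3) 1)
  have hn := one_pos.trans_le (h1 n)
  have hpot : ∫⁻ x in supportBall R n, (rieszKernel 1 ⋆ₗ stepSeries R 4) x ≤
      ENNReal.ofReal (75 * (R n ^ 2)⁻¹ + 16 * (1 / 2) ^ n) * V * volume (supportBall R n) := by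
    rw [← setLIntegral_const]
    exact setLIntegral_mono' (measurableSet_supportBall R n)
      fun x hx => lconvolution_rieszKernel_stepSeries_le h1 hR hx
  calc _ ≤ ENNReal.ofReal (R n ^ 4)⁻¹ * (ENNReal.ofReal (75 * (R n ^ 2)⁻¹ + 16 * (1 / 2) ^ n) *
        V * (ENNReal.ofReal (8 * R n ^ 3) * V)) := by
        gcongr
        exact hpot.trans_eq (by rw [volume_supportBall hn])
    _ = ENNReal.ofReal ((R n ^ 4)⁻¹ * (75 * (R n ^ 2)⁻¹ + 16 * (1 / 2) ^ n) * (8 * R n ^ 3)) *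
        V ^ 2 := by
        rw [ENNReal.ofReal_mul (q := 8 * _) (by positivity),
          ENNReal.ofReal_mul (p := (R n ^ 4)⁻¹) (by positivity)]
        ring
    _ ≤ _ := by
        gcongr ENNReal.ofReal ?_ * _
        calc _ = 600 * (R n ^ 3)⁻¹ + (R n)⁻¹ * (128 * (1 / 2) ^ n) := by field_simp; ring
          _ ≤ _ := by
              gcongr _ + ?_
              exact mul_le_of_le_one_left (by positivity) (inv_le_one_of_one_le₀ (h1 n))

theorem coulombEnergy_bumpSeries_lt_top (h1 : ∀ n, 1 ≤ R n) (hR : ∀ n, R n ≤ n + 1)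
    (hsum : Summable fun n => (R n ^ 3)⁻¹) : coulombEnergy (bumpSeries R) < ⊤ := by
  have h0 (n : ℕ) : 0 < R n := one_pos.trans_le (h1 n)
  have hu := enorm_bumpSeries_pow_le h0 hR two_ne_zero
  calc coulombEnergy (bumpSeries R)
      = ∫⁻ x, ‖bumpSeries R x‖ₑ ^ 2 * (rieszKernel 1 ⋆ₗ fun y => ‖bumpSeries R y‖ₑ ^ 2) x :=
        coulombEnergy_eq_lintegral_mul_lconvolution _
    _ ≤ ∫⁻ x, (rieszKernel 1 ⋆ₗ stepSeries R 4) x * stepSeries R 4 x := by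
        refine lintegral_mono fun x => ?_
        rw [mul_comm]
        gcongr
        · exact lintegral_mono fun y => mul_le_mul_right (hu _) _
        · exact hu x
    _ = ∑' n, ENNReal.ofReal (R n ^ 4)⁻¹ *
          ∫⁻ x in supportBall R n, (rieszKernel 1 ⋆ₗ stepSeries R 4) x :=
        lintegral_mul_stepSeries (measurable_lconvolution _ (measurable_rieszKernel 1)
          (measurable_stepSeries R 4)) 4
    _ ≤ ∑' n, ENNReal.ofReal (600 * (R n ^ 3)⁻¹ + 128 * (1 / 2) ^ n) *
          volume (ball (0 : R3) 1) ^ 2 :=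
        ENNReal.tsum_le_tsum (mul_setLIntegral_supportBall_lconvolution_le h1 hR)
    _ < ⊤ := by
        rw [ENNReal.tsum_mul_right]
        exact ENNReal.mul_lt_top ((hsum.mul_left 600).add
          (summable_geometric_two.mul_left 128)).tsum_ofReal_lt_top
          (ENNReal.pow_lt_top measure_ball_lt_top)

theorem setLIntegral_enorm_bumpSeries_rpow (h0 : ∀ n, 0 < R n) (hR : ∀ n, R n ≤ n + 1) {q : ℝ}
    (hq : 0 ≤ q) (n : ℕ) :
    ∫⁻ x in closedBall (farCenter n) (R n), ‖bumpSeries R x‖ₑ ^ q =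
      ENNReal.ofReal ((R n ^ 2)⁻¹ ^ q * R n ^ 3) * volume (ball (0 : R3) 1) := by
  have hr := h0 n
  have hval : EqOn (fun x => ‖bumpSeries R x‖ₑ ^ q) (fun _ => ENNReal.ofReal ((R n ^ 2)⁻¹ ^ q))
      (closedBall (farCenter n) (R n)) := fun x hx => by
    have hx' : x ∈ supportBall R n := closedBall_subset_closedBall (by linarith) hx
    simp only
    rw [bumpSeries_eq_of_dist_lt h0 hR hx' (by simp), scaledBump_eq_of_mem hr hx,
      Real.enorm_of_nonneg (by positivity), ENNReal.ofReal_rpow_of_nonneg (by positivity) hq]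
  rw [setLIntegral_congr_fun isClosed_closedBall.measurableSet hval, setLIntegral_const,
    Measure.addHaar_closedBall _ _ hr.le, finrank_euclideanSpace_fin,
    ENNReal.ofReal_mul (by positivity), mul_assoc]

theorem not_memLp_bumpSeries (h0 : ∀ n, 0 < R n) (hR : ∀ n, R n ≤ n + 1) {p : ℝ≥0∞} (hp0 : p ≠ 0)
    (hptop : p ≠ ⊤) (hdiv : ¬ Summable fun n => (R n ^ 2)⁻¹ ^ p.toReal * R n ^ 3) :
    ¬ MemLp (bumpSeries R) p volume := fun hmem => by
  have hdisj : Pairwise (Function.onFun Disjoint fun n => closedBall (farCenter n) (R n)) :=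
    fun m n hmn => (pairwise_disjoint_supportBall hR hmn).mono
      (closedBall_subset_closedBall (by linarith [h0 m]))
      (closedBall_subset_closedBall (by linarith [h0 n]))
  have htop : ∑' n, ENNReal.ofReal ((R n ^ 2)⁻¹ ^ p.toReal * R n ^ 3) = ⊤ := by
    by_contra hne
    refine hdiv ((ENNReal.summable_toReal hne).congr fun n => ENNReal.toReal_ofReal ?_)
    have := h0 n
    positivity
  refine (lintegral_rpow_enorm_lt_top_of_eLpNorm_lt_top hp0 hptop hmem.2).ne (top_unique ?_)
  calc ⊤ = (∑' n, ENNReal.ofReal ((R n ^ 2)⁻¹ ^ p.toReal * R n ^ 3)) *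
        volume (ball (0 : R3) 1) := by
        rw [htop, ENNReal.top_mul (measure_ball_pos volume _ one_pos).ne']
    _ = ∑' n, ∫⁻ x in closedBall (farCenter n) (R n), ‖bumpSeries R x‖ₑ ^ p.toReal := by
        simp only [setLIntegral_enorm_bumpSeries_rpow h0 hR ENNReal.toReal_nonneg,
          ENNReal.tsum_mul_right]
    _ = ∫⁻ x in ⋃ n, closedBall (farCenter n) (R n), ‖bumpSeries R x‖ₑ ^ p.toReal :=
        (lintegral_iUnion (fun n => isClosed_closedBall.measurableSet) hdisj _).symm
    _ ≤ ∫⁻ x, ‖bumpSeries R x‖ₑ ^ p.toReal := setLIntegral_le_lintegral _ _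

end BumpSeries

theorem inv_sq_rpow_rpow_mul_cube {b : ℝ} (hb : 0 < b) (α q : ℝ) :
    ((b ^ α) ^ 2)⁻¹ ^ q * (b ^ α) ^ 3 = b ^ (-(α * (2 * q - 3))) := by
  rw [← Real.rpow_mul_natCast hb.le, ← Real.rpow_mul_natCast hb.le, ← Real.rpow_neg hb.le,
    ← Real.rpow_mul hb.le, ← Real.rpow_add hb]
  congr 1
  push_cast
  ring

/- For `q ≥ 2` the exponent `α = 1 / (2 q - 3)` lies in `(1/3, 1]` and turns the last series into
the harmonic one. -/
theorem exists_radii {q : ℝ} (hq : q < 3) : ∃ R : ℕ → ℝ, (∀ n, 1 ≤ R n) ∧ (∀ n, R n ≤ n + 1) ∧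
    (Summable fun n => (R n ^ 3)⁻¹) ∧ ¬ Summable fun n => (R n ^ 2)⁻¹ ^ q * R n ^ 3 := by
  set s : ℝ := max q 2
  have hqs : q ≤ s := le_max_left _ _
  have h2s : 2 ≤ s := le_max_right _ _
  have hs3 : s < 3 := max_lt hq (by norm_num)
  have hpos : 0 < 2 * s - 3 := by linarith
  set α : ℝ := 1 / (2 * s - 3)
  have hα0 : 0 ≤ α := by positivity
  have hα1 : α ≤ 1 := by rw [div_le_one hpos]; linarith
  have hα3 : 1 < α * 3 := by rw [div_mul_eq_mul_div, one_lt_div hpos]; linarith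
  have hαq : α * (2 * q - 3) ≤ 1 := by rw [div_mul_eq_mul_div, div_le_one hpos]; linarith
  have hbase (n : ℕ) : (1 : ℝ) ≤ n + 1 := by linarith [Nat.cast_nonneg (α := ℝ) n]
  refine ⟨fun n => (n + 1) ^ α, fun n => Real.one_le_rpow (hbase n) hα0, fun n => ?_, ?_, ?_⟩
  · simpa using Real.rpow_le_rpow_of_exponent_le (hbase n) hα1
  · refine ((summable_nat_add_iff 1).mpr (Real.summable_nat_rpow_inv.mpr hα3)).congr fun n => ?_
    rw [← Real.rpow_mul_natCast (zero_le_one.trans (hbase n))]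
    push_cast
    rfl
  · refine fun hsum => Real.not_summable_natCast_inv ((summable_nat_add_iff 1).mp
      (.of_nonneg_of_le (fun n => by positivity) (fun n => ?_) hsum))
    rw [inv_sq_rpow_rpow_mul_cube (one_pos.trans_le (hbase n)), Nat.cast_add_one,
      ← Real.rpow_neg_one]
    exact Real.rpow_le_rpow_of_exponent_le (hbase n) (by linarith)

theorem not_spaceE_subset_spaceLp {p : ℝ≥0∞} (hp0 : 0 < p) (hp3 : p < 3) :
    ¬ spaceE ⊆ spaceLp p := fun hsub => by
  have hptop : p ≠ ⊤ := hp3.ne_top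
  have hq : p.toReal < 3 := by simpa using ENNReal.toReal_strict_mono (by simp) hp3
  obtain ⟨R, h1, hR, hsum, hdiv⟩ := exists_radii hq
  exact not_memLp_bumpSeries (fun n => one_pos.trans_le (h1 n)) hR hp0.ne' hptop hdiv
    (hsub ⟨bumpSeries_mem_spaceD12 h1 hR hsum, coulombEnergy_bumpSeries_lt_top h1 hR hsum⟩)

theorem theorem1p5 :
    (∀ p : ℝ≥0∞, 3 ≤ p → p < 6 → spaceE ⊆ spaceLp p) ∧
    (∀ p : ℝ≥0∞, 0 < p → p < 3 → ¬ spaceE ⊆ spaceLp p) :=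
  ⟨fun _ hp3 hp6 => spaceE_subset_spaceLp hp3 hp6.le, fun _ => not_spaceE_subset_spaceLp⟩
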